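/- Write $\mathcal M_d$ for the complex $d\times d$ matrices, and call a positive semi-definite matrix of unit trace a state. A channel is a completely positive trace-preserving linear map $\Phi:\mathcal M_{d}\to\mathcal M_{d'}$. Two channels $\Phi:\mathcal M_d\to\mathcal M_{d_{\mathrm{out}}}$ and $\Phi_c:\mathcal M_d\to\mathcal M_{d_{\mathrm{env}}}$ are complementary if there is an isometry $V:\mathbb C^d\to\mathbb C^{d_{\mathrm{out}}}\otimes\mathbb C^{d_{\mathrm{env}}}$ such that $\Phi(X)=\operatorname{Tr}_{\mathrm{env}}(VXV^\dagger)$ and $\Phi_c(X)=\operatorname{Tr}_{\mathrm{out}}(VXV^\dagger)$ for all $X\in\mathcal M_d$. Let $\mathcal C_\Phi$ be the collection of all channels complementary to $\Phi$, let $d^*_{\mathrm{env}}(\Phi)$ be the least $m$ for which some $\Phi_c\in\mathcal C_\Phi$ maps into $\mathcal M_m$, and let $d^*_{\mathrm{out}}(\Phi)=d^*_{\mathrm{env}}(\Phi_c)$ for $\Phi_c\in\mathcal C_\Phi$ (this does not depend on $\Phi_c$). The quantum capacity of $\Phi$ is given by $$\mathcal Q(\Phi)=\lim_{n\to\infty}\frac{\mathcal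 Q^{(1)}(\Phi^{\otimes n})}{n},\qquad \mathcal Q^{(1)}(\Phi)=\max_{\rho\text{ a state}}\bigl(S(\Phi(\rho))-S(\Phi_c(\rho))\bigr),$$ where $\Phi_c\in\mathcal C_\Phi$ (the value does not depend on the choice) and $S(\rho)=-\operatorname{Tr}(\rho\log\rho)$. A channel $\Phi:\mathcal M_d\to\mathcal M_d$ is diagonal unitary covariant (DUC), respectively conjugate diagonal unitary covariant (CDUC), if for all diagonal unitary $U\in\mathcal M_d$ and all $X\in\mathcal M_d$ one has $\Phi(UXU^\dagger)=U^\dagger\Phi(X)U$, respectively $\Phi(UXU^\dagger)=U\Phi(X)U^\dagger$. **Theorem.** Let $|e\rangle=\sum_i|i\rangle\in\mathbb C^d$, and let $\Phi:\mathcal M_d\to\mathcal M_d$ be a DUC or a CDUC channel such that $$\operatorname{rank}\Phi(|e\rangle\langle e|)=\min\{d^*_{\mathrm{out}}(\Phi),d^*_{\mathrm{env}}(\Phi)\}.$$ Then: 1. if $d^*_{\mathrm{out}}(\Phi)>d^*_{\mathrm{env}}(\Phi)$, the channel $\Phi$ has positive quantum capacity, $\mathcal Q(\Phi)>0$; 2.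 if $d^*_{\mathrm{out}}(\Phi)<d^*_{\mathrm{env}}(\Phi)$, every complementary channel $\Phi_c\in\mathcal C_\Phi$ has positive quantum capacity, $\mathcal Q(\Phi_c)>0$. -/

import Mathlib

open Filter Topology
open scoped Matrix ComplexOrder

namespace QCap

/-- The space of complex square matrices with rows and columns indexed by `a`. -/
abbrev Mat (a : Type) : Type := Matrix a a ℂ

/-- A linear map between matrix spaces. -/
abbrev MatMap (a b : Type) : Type := Mat a →ₗ[ℂ] Mat b

section Channels

variable {a b e : Type} [Fintype a] [DecidableEq a] [Fintype b] [DecidableEq b]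
  [Fintype e] [DecidableEq e]

/-- A quantum state: a positive semi-definite matrix of unit trace. -/
def IsState (ρ : Mat a) : Prop := ρ.PosSemidef ∧ ρ.trace = 1

/-- The ampliation `id_k ⊗ Φ`, acting on `k × k` block matrices blockwise. -/
def ampliation (k : ℕ) (Φ : MatMap a b) (X : Mat (Fin k × a)) : Mat (Fin k × b) :=
  Matrix.of fun p q => Φ (Matrix.of fun x y => X (p.1, x) (q.1, y)) p.2 q.2

/-- Complete positivity: every ampliation preserves positive semi-definiteness. -/
def IsCompletelyPositive (Φ : MatMap a b) : Prop :=
  ∀ (k : ℕ) (X : Mat (Fin k × a)), X.PosSemidef → (ampliation k Φ X).PosSemidef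

/-- A quantum channel: a completely positive and trace preserving linear map. -/
def IsChannel (Φ : MatMap a b) : Prop :=
  IsCompletelyPositive Φ ∧ ∀ X : Mat a, (Φ X).trace = X.trace

/-- Partial trace over the second tensor factor. -/
def traceSnd (M : Mat (b × e)) : Mat b := Matrix.of fun i j => ∑ k, M (i, k) (j, k)

/-- Partial trace over the first tensor factor. -/
def traceFst (M : Mat (b × e)) : Mat e := Matrix.of fun i j => ∑ k, M (k, i) (k, j)

/-- `Φ` and `Φc` are complementary: a single (Stinespring) isometry
`V : ℂ^a → ℂ^b ⊗ ℂ^e` yields `Φ` by tracing out the environment and `Φc` by tracing out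
the output.  Both maps are then automatically channels. -/
def IsComplementary (Φ : MatMap a b) (Φc : MatMap a e) : Prop :=
  ∃ V : Matrix (b × e) a ℂ, Vᴴ * V = 1 ∧
    ∀ X : Mat a, Φ X = traceSnd (V * X * Vᴴ) ∧ Φc X = traceFst (V * X * Vᴴ)

/-- The minimal environment dimension: the least `m` such that some channel with output
dimension `m` is complementary to `Φ`. -/
noncomputable def minEnvDim (Φ : MatMap a b) : ℕ :=
  sInf {m : ℕ | ∃ Φc : MatMap a (Fin m), IsComplementary Φ Φc}

/-- The minimal output dimension: the minimal environment dimension of a channel `Φc`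
complementary to `Φ`.  This number is the same for all such `Φc`, so that the infimum is
taken over a one-element set. -/
noncomputable def minOutDim (Φ : MatMap a b) : ℕ :=
  sInf {r : ℕ | ∃ (m : ℕ) (Φc : MatMap a (Fin m)), IsComplementary Φ Φc ∧ r = minEnvDim Φc}

/-- The von Neumann entropy `S(ρ) = -Tr(ρ log ρ)`, where `log ρ` is taken in the functional
calculus of Hermitian matrices (natural logarithm, `Real.log 0 = 0`, so `0 log 0 = 0`). -/
noncomputable def entropy (ρ : Mat a) : ℝ := -((ρ * cfc Real.log ρ).trace).re

/-- The values `I_c(ρ; Φ) = S(Φ(ρ)) - S(Φc(ρ))`, for `ρ` a state and `Φc` a channel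
complementary to `Φ`.  For fixed `ρ` the value is the same for all such `Φc`. -/
def coherentInfoValues (Φ : MatMap a b) : Set ℝ :=
  {r : ℝ | ∃ (m : ℕ) (Φc : MatMap a (Fin m)) (ρ : Mat a),
    IsComplementary Φ Φc ∧ IsState ρ ∧ r = entropy (Φ ρ) - entropy (Φc ρ)}

/-- The coherent information `Q⁽¹⁾(Φ)` of a channel: the maximum of `I_c(ρ; Φ)` over all
states `ρ`. -/
noncomputable def coherentInfo (Φ : MatMap a b) : ℝ := sSup (coherentInfoValues Φ)

/-- The `n`-fold tensor power `Φ^{⊗n}`, where the matrix space `M(a)^{⊗n}` is the space of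
matrices indexed by `Fin n → a`.  It sends the matrix unit `E_{k₁l₁} ⊗ ⋯ ⊗ E_{kₙlₙ}` to
`Φ(E_{k₁l₁}) ⊗ ⋯ ⊗ Φ(E_{kₙlₙ})`. -/
noncomputable def tensorPower (Φ : MatMap a b) (n : ℕ) : MatMap (Fin n → a) (Fin n → b) where
  toFun X := Matrix.of fun i j =>
    ∑ k, ∑ l, X k l * ∏ t, Φ (Matrix.single (k t) (l t) 1) (i t) (j t)
  map_add' X Y := by
    ext i j
    simp [add_mul, Finset.sum_add_distrib]
  map_smul' c X := by
    ext i j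
    simp [Finset.mul_sum, mul_assoc]

/-- `Q` is the quantum capacity of `Φ`: the sequence `Q⁽¹⁾(Φ^{⊗n}) / n` converges to `Q`. -/
def IsQuantumCapacity (Φ : MatMap a b) (Q : ℝ) : Prop :=
  Tendsto (fun n : ℕ => coherentInfo (tensorPower Φ n) / (n : ℝ)) atTop (𝓝 Q)

/-- The quantum capacity of `Φ` (exists and) is positive. -/
def HasPositiveQuantumCapacity (Φ : MatMap a b) : Prop :=
  ∃ Q : ℝ, IsQuantumCapacity Φ Q ∧ 0 < Q

/-- Diagonal unitary covariance: `Φ(U X U†) = U† Φ(X) U` for all diagonal unitaries `U`. -/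
def IsDUC (Φ : MatMap a a) : Prop :=
  ∀ U ∈ Matrix.unitaryGroup a ℂ, U.IsDiag → ∀ X : Mat a, Φ (U * X * Uᴴ) = Uᴴ * Φ X * U

/-- Conjugate diagonal unitary covariance: `Φ(U X U†) = U Φ(X) U†` for all diagonal
unitaries `U`. -/
def IsCDUC (Φ : MatMap a a) : Prop :=
  ∀ U ∈ Matrix.unitaryGroup a ℂ, U.IsDiag → ∀ X : Mat a, Φ (U * X * Uᴴ) = U * Φ X * Uᴴ

end Channels

/-- The matrix `|e⟩⟨e|` for the vector `|e⟩ = ∑ i, |i⟩`. -/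
def eProj (d : ℕ) : Mat (Fin d) :=
  Matrix.vecMulVec (fun _ : Fin d => (1 : ℂ)) (star fun _ : Fin d => (1 : ℂ))

end QCap

/-! Let `Ψ` be complementary to `Φ`. On a pure state `P` the two outputs have the same nonzero
spectrum, hence equal rank and equal entropy, so the coherent information vanishes there. The
minimal output and environment dimensions are the ranks of `Φ 1` and `Ψ 1`. If the latter is smaller
and the rank of `Φ P` equals it, then `Ψ P` already fills the support of `Ψ 1`, while `Φ P` has
smaller rank than `Φ 1`.

Now mix `P` with weight `ε` of the maximally mixed state. The entropy of the `Φ` output grows at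
least like a positive multiple of `ε log (1/ε)`, since new support opens up; that of the `Ψ` output
grows by at most `O(ε)`. For small `ε` the coherent information is positive
(`exists_mix_entropy_lt`). It is superadditive over tensor powers and bounded by `n log (dim)`, so
Fekete's lemma gives existence and positivity of the capacity. The second claim is the first with
the roles of `Φ` and its complement exchanged. -/

namespace QCap

open Matrix

/-! ### Von Neumann entropy and Klein's inequality. -/

section Entropy

variable {a b : Type} [Fintype a] [DecidableEq a] [Fintype b] [DecidableEq b]

theorem trace_mul_cfc {σ : Mat a} (hσ : σ.IsHermitian) (B : Mat a) (f : ℝ → ℝ) :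
    (B * cfc f σ).trace = ∑ j, (f (hσ.eigenvalues j) : ℂ) *
      ((hσ.eigenvectorUnitary : Mat a)ᴴ * B * (hσ.eigenvectorUnitary : Mat a)) j j := by
  rw [hσ.cfc_eq, IsHermitian.cfc, Unitary.conjStarAlgAut_apply, ← mul_assoc, trace_mul_comm,
    ← mul_assoc, ← mul_assoc, trace]
  refine Finset.sum_congr rfl fun j _ => ?_
  rw [diag_apply, mul_diagonal, mul_comm]
  rfl

theorem conjTranspose_mul_mul_apply {n : Type} [Fintype n] (U B : Mat n) (j : n) :
    (Uᴴ * B * U) j j = star (fun i => U i j) ⬝ᵥ B *ᵥ (fun i => U i j) := by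
  rw [mul_assoc, mul_apply]
  rfl

theorem entropy_eq_sum {ρ : Mat a} (hρ : ρ.IsHermitian) :
    entropy ρ = ∑ j, Real.negMulLog (hρ.eigenvalues j) := by
  have hdiag : ((hρ.eigenvectorUnitary : Mat a)ᴴ * ρ * (hρ.eigenvectorUnitary : Mat a)) =
      diagonal (RCLike.ofReal ∘ hρ.eigenvalues) := by
    have := hρ.conjStarAlgAut_star_eigenvectorUnitary
    rw [Unitary.conjStarAlgAut_apply] at this
    simpa [star_eq_conjTranspose] using this
  rw [entropy, trace_mul_cfc hρ, hdiag]
  simp [Real.negMulLog, mul_comm, Finset.sum_neg_distrib]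

/-- Makes entropy a function of the characteristic polynomial alone, so invariance statements reduce
to identities of characteristic polynomials. -/
theorem entropy_eq_charpoly_roots {ρ : Mat a} (hρ : ρ.IsHermitian) :
    entropy ρ = (ρ.charpoly.roots.map fun z => Real.negMulLog z.re).sum := by
  rw [entropy_eq_sum hρ, hρ.roots_charpoly_eq_eigenvalues, Multiset.map_map]
  simp only [Function.comp_def, RCLike.ofReal_eq_complex_ofReal,
    Complex.ofReal_re]
  rfl

theorem entropy_of_charpoly_eq_prod {ι : Type*} [Fintype ι] {ρ : Mat a} (hρ : ρ.IsHermitian)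
    (x : ι → ℝ) (h : ρ.charpoly = ∏ i, (Polynomial.X - Polynomial.C (x i : ℂ))) :
    entropy ρ = ∑ i, Real.negMulLog (x i) := by
  have hroots : ρ.charpoly.roots = Finset.univ.val.map fun i => (x i : ℂ) := by
    rw [h, ← Polynomial.roots_multiset_prod_X_sub_C (Finset.univ.val.map fun i => (x i : ℂ)),
      Multiset.map_map]
    rfl
  rw [entropy_eq_charpoly_roots hρ, hroots, Multiset.map_map]
  simp only [Function.comp_def, Complex.ofReal_re]
  rfl

theorem sum_eigenvalues_eq_one {ρ : Mat a} (hρ : IsState ρ) :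
    ∑ i, hρ.1.isHermitian.eigenvalues i = 1 := by
  have := hρ.2.symm.trans hρ.1.isHermitian.trace_eq_sum_eigenvalues
  simp only [RCLike.ofReal_eq_complex_ofReal] at this
  exact_mod_cast this.symm

theorem entropy_reindex {ρ : Mat a} (hρ : ρ.IsHermitian) (e : a ≃ b) :
    entropy (reindex e e ρ) = entropy ρ := by
  rw [entropy_eq_charpoly_roots hρ, entropy_eq_charpoly_roots (ρ := reindex e e ρ)
    (hρ.submatrix _), charpoly_reindex]

theorem entropy_transpose {ρ : Mat a} (hρ : ρ.IsHermitian) : entropy ρᵀ = entropy ρ := by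
  rw [entropy_eq_charpoly_roots hρ, entropy_eq_charpoly_roots hρ.transpose, charpoly_transpose]

/-- The two characteristic polynomials agree up to powers of `X`, and the extra zero roots
contribute `negMulLog 0 = 0`. -/
theorem entropy_self_mul_conjTranspose (K : Matrix a b ℂ) :
    entropy (K * Kᴴ) = entropy (Kᴴ * K) := by
  rw [entropy_eq_charpoly_roots (isHermitian_mul_conjTranspose_self K),
    entropy_eq_charpoly_roots (isHermitian_conjTranspose_mul_self K)]
  have h := congrArg (fun p : Polynomial ℂ =>
    (p.roots.map fun z => Real.negMulLog z.re).sum) (charpoly_mul_comm' K Kᴴ)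
  have hne : ∀ (c : Type) [Fintype c] [DecidableEq c] (n : ℕ) (M : Mat c),
      (Polynomial.X ^ n * M.charpoly).roots = n • {0} + M.charpoly.roots := by
    intro c _ _ n M
    rw [Polynomial.roots_mul (mul_ne_zero (pow_ne_zero _ Polynomial.X_ne_zero)
      M.charpoly_monic.ne_zero), Polynomial.roots_X_pow]
  simpa [hne, Multiset.map_nsmul, Multiset.sum_nsmul] using h

theorem conjTranspose_diagonalization {ρ : Mat a} (hρ : ρ.IsHermitian) :
    ρ = (hρ.eigenvectorUnitary : Mat a) * diagonal (fun i => (hρ.eigenvalues i : ℂ)) *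
      (hρ.eigenvectorUnitary : Mat a)ᴴ := by
  have := hρ.spectral_theorem
  rwa [Unitary.conjStarAlgAut_apply] at this

theorem entropy_kronecker {ρ : Mat a} {σ : Mat b} (hρ : IsState ρ) (hσ : IsState σ) :
    entropy (kroneckerMap (· * ·) ρ σ) = entropy ρ + entropy σ := by
  have h₁ := hρ.1.isHermitian
  have h₂ := hσ.1.isHermitian
  have hkr : (kroneckerMap (· * ·) ρ σ).IsHermitian := by
    rw [IsHermitian, conjTranspose_kronecker, h₁.eq, h₂.eq]
  have hchar : (kroneckerMap (· * ·) ρ σ).charpoly =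
      ∏ p : a × b, (Polynomial.X -
        Polynomial.C ((h₁.eigenvalues p.1 * h₂.eigenvalues p.2 : ℝ) : ℂ)) := by
    conv_lhs => rw [conjTranspose_diagonalization h₁, conjTranspose_diagonalization h₂]
    rw [mul_kronecker_mul, mul_kronecker_mul, charpoly_mul_comm, ← mul_assoc,
      ← mul_kronecker_mul]
    have e₁ : (h₁.eigenvectorUnitary : Mat a)ᴴ * (h₁.eigenvectorUnitary : Mat a) = 1 :=
      Unitary.coe_star_mul_self _
    have e₂ : (h₂.eigenvectorUnitary : Mat b)ᴴ * (h₂.eigenvectorUnitary : Mat b) = 1 :=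
      Unitary.coe_star_mul_self _
    rw [e₁, e₂, one_kronecker_one, one_mul, diagonal_kronecker_diagonal, charpoly_diagonal]
    simp
  rw [entropy_of_charpoly_eq_prod hkr _ hchar, entropy_eq_sum h₁, entropy_eq_sum h₂,
    Fintype.sum_prod_type]
  simp_rw [Real.negMulLog_mul, Finset.sum_add_distrib, ← Finset.sum_mul, ← Finset.mul_sum]
  rw [← Finset.sum_mul, sum_eigenvalues_eq_one hρ, sum_eigenvalues_eq_one hσ, one_mul, one_mul]

/-- The squared overlaps of the two eigenbases form a doubly stochastic matrix, which reduces the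
claim to the scalar inequality `p log p - p log q ≥ p - q`. The kernel condition is needed because
`Real.log 0 = 0` stands where the true value would be infinite. -/
theorem klein_inequality {ρ σ : Mat a} (hρ : ρ.PosSemidef) (hσ : σ.PosSemidef)
    (htr : ρ.trace = σ.trace) (hker : ∀ v, σ *ᵥ v = 0 → ρ *ᵥ v = 0) :
    entropy ρ ≤ -((ρ * cfc Real.log σ).trace).re := by
  have h₁ := hρ.isHermitian
  have h₂ := hσ.isHermitian
  set p := h₁.eigenvalues with hp
  set q := h₂.eigenvalues with hq
  set M : Mat a := (h₂.eigenvectorUnitary : Mat a)ᴴ * (h₁.eigenvectorUnitary : Mat a) with hM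
  have e₁ : (h₁.eigenvectorUnitary : Mat a) * (h₁.eigenvectorUnitary : Mat a)ᴴ = 1 :=
    Unitary.coe_mul_star_self _
  have e₂ : (h₂.eigenvectorUnitary : Mat a)ᴴ * (h₂.eigenvectorUnitary : Mat a) = 1 :=
    Unitary.coe_star_mul_self _
  have e₃ : (h₁.eigenvectorUnitary : Mat a)ᴴ * (h₁.eigenvectorUnitary : Mat a) = 1 :=
    Unitary.coe_star_mul_self _
  have e₄ : (h₂.eigenvectorUnitary : Mat a) * (h₂.eigenvectorUnitary : Mat a)ᴴ = 1 :=
    Unitary.coe_mul_star_self _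
  have hMM : M * Mᴴ = 1 := by
    rw [hM, conjTranspose_mul, conjTranspose_conjTranspose, mul_assoc, ← mul_assoc _ _
      (h₂.eigenvectorUnitary : Mat a), e₁, one_mul, e₂]
  have hMM' : Mᴴ * M = 1 := mul_eq_one_comm.1 hMM
  have hrow : ∀ j, ∑ i, Complex.normSq (M j i) = 1 := by
    intro j
    have := congrFun (congrFun hMM j) j
    simp only [mul_apply, conjTranspose_apply, one_apply_eq, RCLike.star_def,
      Complex.mul_conj] at this
    exact_mod_cast this
  have hcol : ∀ i, ∑ j, Complex.normSq (M j i) = 1 := by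
    intro i
    have := congrFun (congrFun hMM' i) i
    simp only [mul_apply, conjTranspose_apply, one_apply_eq, RCLike.star_def,
      mul_comm (_root_.starRingEnd ℂ _), Complex.mul_conj] at this
    exact_mod_cast this
  have hquad : ∀ j, ((h₂.eigenvectorUnitary : Mat a)ᴴ * ρ * (h₂.eigenvectorUnitary : Mat a)) j j
      = ((∑ i, p i * Complex.normSq (M j i) : ℝ) : ℂ) := by
    intro j
    conv_lhs => rw [conjTranspose_diagonalization h₁]
    have : (h₂.eigenvectorUnitary : Mat a)ᴴ * ((h₁.eigenvectorUnitary : Mat a) *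
        diagonal (fun i => (h₁.eigenvalues i : ℂ)) * (h₁.eigenvectorUnitary : Mat a)ᴴ) *
        (h₂.eigenvectorUnitary : Mat a) = M * diagonal (fun i => (p i : ℂ)) * Mᴴ := by
      rw [hM, conjTranspose_mul, conjTranspose_conjTranspose]
      simp only [mul_assoc, hp]
    rw [this, mul_apply]
    push_cast
    refine Finset.sum_congr rfl fun i _ => ?_
    rw [mul_diagonal, conjTranspose_apply, RCLike.star_def, ← Complex.mul_conj]
    ring
  -- An eigenvector of `σ` for eigenvalue zero is killed by `ρ`, so all weights `p i * |M j i|²` in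
  -- its row vanish.
  have hzero : ∀ j, q j = 0 → ∀ i, p i * Complex.normSq (M j i) = 0 := by
    intro j hj
    have hv := h₂.mulVec_eigenvectorBasis j
    rw [← hq, hj, zero_smul] at hv
    have h0 := hquad j
    rw [conjTranspose_mul_mul_apply] at h0
    have hcolv : (fun i => (h₂.eigenvectorUnitary : Mat a) i j) = h₂.eigenvectorBasis j := by
      ext i; exact h₂.eigenvectorUnitary_apply i j
    rw [hcolv, hker _ hv, dotProduct_zero] at h0
    have h0' : ∑ i, p i * Complex.normSq (M j i) = 0 := by exact_mod_cast h0.symm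
    have := (Finset.sum_eq_zero_iff_of_nonneg fun i _ =>
      mul_nonneg (hρ.eigenvalues_nonneg i) (Complex.normSq_nonneg _)).1 h0'
    exact fun i => this i (Finset.mem_univ i)
  have htr' : ∑ i, p i = ∑ j, q j := by
    have := h₁.trace_eq_sum_eigenvalues.symm.trans (htr.trans h₂.trace_eq_sum_eigenvalues)
    exact_mod_cast this
  have hlhs : entropy ρ = ∑ j, ∑ i, Complex.normSq (M j i) * -(p i * Real.log (p i)) := by
    rw [entropy_eq_sum h₁, Finset.sum_comm]
    refine Finset.sum_congr rfl fun i _ => ?_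
    rw [← Finset.sum_mul, hcol, one_mul, Real.negMulLog, ← hp]
    ring
  have hrhs : -((ρ * cfc Real.log σ).trace).re =
      ∑ j, ∑ i, Complex.normSq (M j i) * -(p i * Real.log (q j)) := by
    rw [trace_mul_cfc h₂]
    simp_rw [hquad, ← Complex.ofReal_mul, ← Complex.ofReal_sum, Complex.ofReal_re]
    rw [← Finset.sum_neg_distrib]
    refine Finset.sum_congr rfl fun j _ => ?_
    rw [Finset.mul_sum, ← Finset.sum_neg_distrib]
    exact Finset.sum_congr rfl fun i _ => by ring
  have hdiff : ∑ j, ∑ i, Complex.normSq (M j i) * (p i - q j) = 0 := by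
    simp_rw [mul_sub, Finset.sum_sub_distrib]
    rw [Finset.sum_comm]
    simp_rw [← Finset.sum_mul, hcol, hrow, one_mul, htr', sub_self]
  rw [hlhs, hrhs, ← sub_nonneg, ← hdiff, ← Finset.sum_sub_distrib]
  refine Finset.sum_le_sum fun j _ => ?_
  rw [← Finset.sum_sub_distrib]
  refine Finset.sum_le_sum fun i _ => ?_
  have hp0 : 0 ≤ p i := hρ.eigenvalues_nonneg i
  have hn := Complex.normSq_nonneg (M j i)
  rcases (hσ.eigenvalues_nonneg j).eq_or_lt' with hq0 | hq0
  · have := hzero j hq0 i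
    change q j = 0 at hq0
    rw [hq0, sub_zero, mul_comm, this]
    rcases mul_eq_zero.1 this with h | h <;> simp [h]
  · change 0 < q j at hq0
    rw [← mul_sub]
    refine mul_le_mul_of_nonneg_left ?_ hn
    rcases hp0.eq_or_lt' with hp0 | hp0
    · rw [hp0]; simp [hq0.le]
    · have := Real.log_le_sub_one_of_pos (div_pos hq0 hp0)
      rw [Real.log_div hq0.ne' hp0.ne'] at this
      have h2 := mul_le_mul_of_nonneg_left this hp0.le
      have h3 : p i * (q j / p i - 1) = q j - p i := by field_simp
      linarith

theorem entropy_nonneg {ρ : Mat a} (hρ : IsState ρ) : 0 ≤ entropy ρ := by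
  have h₁ := hρ.1.isHermitian
  rw [entropy_eq_sum h₁]
  have t₁ : ∑ i, h₁.eigenvalues i = 1 := sum_eigenvalues_eq_one hρ
  refine Finset.sum_nonneg fun i _ => Real.negMulLog_nonneg (hρ.1.eigenvalues_nonneg i) ?_
  rw [← t₁]
  exact Finset.single_le_sum (fun i _ => hρ.1.eigenvalues_nonneg i) (Finset.mem_univ i)

theorem entropy_le_log_card {ρ : Mat a} (hρ : IsState ρ) :
    entropy ρ ≤ Real.log (Fintype.card a) := by
  have hne : Nonempty a := by
    by_contra h
    rw [not_nonempty_iff] at h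
    have := hρ.2
    simp [trace] at this
  have hc : (0 : ℝ) < Fintype.card a := by exact_mod_cast Fintype.card_pos
  have h₁ := hρ.1.isHermitian
  have t₁ : ∑ i, h₁.eigenvalues i = 1 := sum_eigenvalues_eq_one hρ
  rw [entropy_eq_sum h₁]
  -- Tangent-line bound for the logarithm at the uniform distribution; the correction terms sum to
  -- zero.
  have key : ∀ i, Real.negMulLog (h₁.eigenvalues i) ≤
      h₁.eigenvalues i * Real.log (Fintype.card a) + ((Fintype.card a : ℝ)⁻¹ - h₁.eigenvalues i) := by
    intro i
    rcases (hρ.1.eigenvalues_nonneg i).eq_or_lt' with hp | hp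
    · rw [hp]; simp
    · have := Real.log_le_sub_one_of_pos (inv_pos.2 (mul_pos hc hp))
      rw [Real.log_inv, Real.log_mul hc.ne' hp.ne'] at this
      have h2 := mul_le_mul_of_nonneg_left this hp.le
      have h3 : h₁.eigenvalues i * ((Fintype.card a * h₁.eigenvalues i)⁻¹ - 1) =
        (Fintype.card a : ℝ)⁻¹ - h₁.eigenvalues i := by field_simp
      rw [Real.negMulLog]
      linarith
  refine (Finset.sum_le_sum fun i _ => key i).trans_eq ?_
  rw [Finset.sum_add_distrib, Finset.sum_sub_distrib, ← Finset.sum_mul, t₁]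
  simp [hc.ne']

end Entropy

/-! ### Growth of entropy under mixing. -/

section Perturbation

variable {a b : Type} [Fintype a] [DecidableEq a] [Fintype b] [DecidableEq b]

theorem mulVec_eq_zero_of_add_mulVec_eq_zero {n : Type} [Fintype n] {P Q : Mat n}
    (hP : P.PosSemidef) (hQ : Q.PosSemidef) {v : n → ℂ} (h : (P + Q) *ᵥ v = 0) : P *ᵥ v = 0 := by
  have h0 : star v ⬝ᵥ P *ᵥ v + star v ⬝ᵥ Q *ᵥ v = 0 := by
    rw [← dotProduct_add, ← add_mulVec, h, dotProduct_zero]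
  have hP0 := hP.dotProduct_mulVec_nonneg v
  have hQ0 := hQ.dotProduct_mulVec_nonneg v
  exact (hP.dotProduct_mulVec_zero_iff v).1 ((add_eq_zero_iff_of_nonneg hP0 hQ0).1 h0).1

/-- Otherwise `A` is injective on the range of `B`, and `rank B = rank (A * B) ≤ rank A`. -/
theorem exists_mulVec_mem_ker_of_rank_lt {n : Type} [Fintype n] {A B : Mat n}
    (h : A.rank < B.rank) :
    ∃ w, A *ᵥ (B *ᵥ w) = 0 ∧ B *ᵥ w ≠ 0 := by
  by_contra! hcon
  have hker : LinearMap.ker (A * B).mulVecLin = LinearMap.ker B.mulVecLin := by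
    ext w
    simp only [LinearMap.mem_ker, mulVecLin_apply, ← mulVec_mulVec]
    exact ⟨hcon w, fun h => by rw [h, mulVec_zero]⟩
  have h₁ := LinearMap.finrank_range_add_finrank_ker (A * B).mulVecLin
  have h₂ := LinearMap.finrank_range_add_finrank_ker B.mulVecLin
  have h₃ := rank_mul_le_left A B
  rw [hker] at h₁
  simp only [rank] at *
  omega

/-- Cauchy–Schwarz for the form `B` gives this with constant `⟨w, B w⟩`; the extra `1` keeps the
constant invertible, so that the explicit sum of positive terms in `key` applies to every `w`. -/
theorem posSemidef_smul_sub_vecMulVec {B : Mat a} (hB : B.PosSemidef) (w : a → ℂ) :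
    ((((star w ⬝ᵥ B *ᵥ w).re + 1 : ℝ) : ℂ) • B - vecMulVec (B *ᵥ w) (star (B *ᵥ w))).PosSemidef := by
  set β : ℝ := (star w ⬝ᵥ B *ᵥ w).re with hβ
  have hnn := Complex.nonneg_iff.1 (hB.dotProduct_mulVec_nonneg w)
  have hβ0 : 0 ≤ β := hnn.1
  have hβw : star w ⬝ᵥ B *ᵥ w = (β : ℂ) := Complex.ext rfl (by simpa using hnn.2.symm)
  set W : Mat a := vecMulVec w (star w) with hW
  have hWH : Wᴴ = W := (posSemidef_vecMulVec_self_star w).isHermitian.eq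
  have hWBW : W * (B * W) = (β : ℂ) • W := by
    rw [hW, mul_vecMulVec, vecMulVec_mul_vecMulVec, hβw, vecMulVec_smul]
  have hBWB : vecMulVec (B *ᵥ w) (star (B *ᵥ w)) = B * (W * B) := by
    rw [star_mulVec, hB.isHermitian.eq, hW, vecMulVec_mul, mul_vecMulVec]
  set c : ℂ := ((β + 1 : ℝ) : ℂ) with hc
  have hc0 : (0 : ℂ) < c := by rw [hc]; exact_mod_cast (by linarith : 0 < β + 1)
  have hcβ : (β : ℂ) = c - 1 := by rw [hc]; push_cast; ring
  have hcc : star c = c := Complex.conj_ofReal _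
  set M : Mat a := c • 1 - W * B with hM
  have hMH : Mᴴ = c • 1 - B * W := by
    rw [hM, conjTranspose_sub, conjTranspose_smul, conjTranspose_one, conjTranspose_mul, hWH,
      hB.isHermitian.eq, hcc]
  have key : c • B - vecMulVec (B *ᵥ w) (star (B *ᵥ w)) =
      c⁻¹ • (Mᴴ * B * M + vecMulVec (B *ᵥ w) (star (B *ᵥ w))) := by
    have : Mᴴ * B * M + B * (W * B) = c • (c • B - B * (W * B)) := by
      have h4 : B * (W * (B * (W * B))) = (c - 1) • (B * (W * B)) := by
        rw [← hcβ, ← mul_assoc B W B, ← mul_assoc W (B * W) B, hWBW, smul_mul_assoc, mul_smul_comm,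
          mul_assoc]
      rw [hMH, hM]
      simp only [sub_mul, mul_sub, smul_mul_assoc, mul_smul_comm, one_mul, mul_one, mul_assoc, h4]
      module
    rw [hBWB, this, smul_smul, inv_mul_cancel₀ hc0.ne', one_smul]
  rw [key]
  exact ((hB.conjTranspose_mul_mul_same M).add (posSemidef_vecMulVec_self_star _)).smul
    (inv_nonneg.2 hc0.le)

/-- As `-log σ ≥ 0` for a state, `c • B` may be replaced by the smaller `P`; then `-log q ≥ 1 - log
t - q / t` is applied to each eigenvalue. The result is linear in `σ`, so no spectral data of `σ`
remain. It is applied with `t = ε` and `Tr (P σ) = O(ε)`. -/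
theorem trace_mul_log_bound {P B σ : Mat a} {c t : ℝ} (hP : P.PosSemidef)
    (hBP : ((c : ℂ) • B - P).PosSemidef) (hσ : IsState σ)
    (hker : ∀ v, σ *ᵥ v = 0 → B *ᵥ v = 0) (ht : 0 < t) :
    P.trace.re * (1 - Real.log t) - (P * σ).trace.re / t ≤
      c * -((B * cfc Real.log σ).trace).re := by
  have h := hσ.1.isHermitian
  set U : Mat a := (h.eigenvectorUnitary : Mat a) with hU
  set q := h.eigenvalues with hq
  have hUU : U * Uᴴ = 1 := Unitary.coe_mul_star_self _
  have htrP : P.trace.re = ∑ j, ((Uᴴ * P * U) j j).re := by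
    rw [← Complex.re_sum]
    congr 1
    change P.trace = (Uᴴ * P * U).trace
    rw [trace_mul_cycle, hUU, one_mul]
  have htrPσ : (P * σ).trace.re = ∑ j, q j * ((Uᴴ * P * U) j j).re := by
    have := trace_mul_cfc h P id
    rw [cfc_id ℝ σ] at this
    rw [this, Complex.re_sum]
    simp only [id, Complex.re_ofReal_mul]
    rfl
  have htrB : ((B * cfc Real.log σ).trace).re =
      ∑ j, Real.log (q j) * ((Uᴴ * B * U) j j).re := by
    rw [trace_mul_cfc h, Complex.re_sum]
    simp only [Complex.re_ofReal_mul]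
    rfl
  rw [htrP, htrPσ, htrB, ← Finset.sum_neg_distrib, Finset.mul_sum, Finset.sum_mul,
    Finset.sum_div, ← Finset.sum_sub_distrib]
  refine Finset.sum_le_sum fun j _ => ?_
  have hPj : 0 ≤ ((Uᴴ * P * U) j j).re :=
    (Complex.nonneg_iff.1 (hP.conjTranspose_mul_mul_same U).diag_nonneg).1
  have hBj : ((Uᴴ * P * U) j j).re ≤ c * ((Uᴴ * B * U) j j).re := by
    have := (Complex.nonneg_iff.1 (PosSemidef.diag_nonneg (hBP.conjTranspose_mul_mul_same U) (i := j))).1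
    rw [mul_sub, sub_mul, mul_smul_comm, smul_mul_assoc, Matrix.sub_apply, Matrix.smul_apply, Complex.sub_re,
      smul_eq_mul, Complex.re_ofReal_mul] at this
    linarith
  have hq1 : q j ≤ 1 := by
    rw [← sum_eigenvalues_eq_one hσ]
    exact Finset.single_le_sum (fun i _ => hσ.1.eigenvalues_nonneg i) (Finset.mem_univ j)
  rcases (hσ.1.eigenvalues_nonneg j).eq_or_lt' with hq0 | hq0
  · change q j = 0 at hq0
    have hv := h.mulVec_eigenvectorBasis j
    rw [← hq, hq0, zero_smul] at hv
    have hcolv : (fun i => U i j) = h.eigenvectorBasis j := by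
      ext i; exact h.eigenvectorUnitary_apply i j
    have hBz : (Uᴴ * B * U) j j = 0 := by
      rw [conjTranspose_mul_mul_apply, hcolv, hker _ hv, dotProduct_zero]
    rw [hBz, Complex.zero_re, mul_zero] at hBj
    have hPz := le_antisymm hBj hPj
    simp [hPz, hBz]
  · change 0 < q j at hq0
    have hlog := Real.log_le_sub_one_of_pos (div_pos hq0 ht)
    rw [Real.log_div hq0.ne' ht.ne'] at hlog
    have h₁ := mul_le_mul_of_nonneg_left hlog hPj
    have h₂ := mul_le_mul_of_nonneg_right hBj (neg_nonneg.2 (Real.log_nonpos hq0.le hq1))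
    have h₃ : q j * ((Uᴴ * P * U) j j).re / t = ((Uᴴ * P * U) j j).re * (q j / t) := by ring
    rw [h₃]
    linarith

theorem IsState.mix {n : Type} [Fintype n] {A B : Mat n} (hA : IsState A) (hB : IsState B)
    {ε : ℝ} (h0 : 0 ≤ ε)
    (h1 : ε ≤ 1) : IsState (((1 - ε : ℝ) : ℂ) • A + (ε : ℂ) • B) := by
  refine ⟨(hA.1.smul ?_).add (hB.1.smul ?_), ?_⟩
  · exact_mod_cast sub_nonneg.2 h1
  · exact_mod_cast h0
  · rw [trace_add, trace_smul, trace_smul, hA.2, hB.2]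
    simp

/-- Mixing a state `A` with a state `B` of larger rank raises the entropy with infinite slope,
whereas the slope is finite for a pair `A'`, `B'` in which the support of `A'` contains that
of `B'`. -/
theorem exists_mix_entropy_lt {A B : Mat a} {A' B' : Mat b} (hA : IsState A) (hB : IsState B)
    (hA' : IsState A') (hB' : IsState B') (hrank : A.rank < B.rank)
    (hent : entropy A = entropy A') (hker : ∀ v, A' *ᵥ v = 0 → B' *ᵥ v = 0) :
    ∃ ε : ℝ, 0 < ε ∧ ε < 1 ∧ entropy (((1 - ε : ℝ) : ℂ) • A' + (ε : ℂ) • B') <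
      entropy (((1 - ε : ℝ) : ℂ) • A + (ε : ℂ) • B) := by
  obtain ⟨w, hAw, hBw⟩ := exists_mulVec_mem_ker_of_rank_lt hrank
  set v := B *ᵥ w with hv
  set P : Mat a := vecMulVec v (star v) with hPdef
  set c : ℝ := (star w ⬝ᵥ B *ᵥ w).re + 1 with hc
  have hc0 : 0 < c := by
    have := (Complex.nonneg_iff.1 (hB.1.dotProduct_mulVec_nonneg w)).1
    linarith
  have hP : P.PosSemidef := posSemidef_vecMulVec_self_star v
  have hBP : ((c : ℂ) • B - P).PosSemidef := posSemidef_smul_sub_vecMulVec hB.1 w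
  have hPtr : 0 < P.trace.re := by
    rw [hPdef, trace_vecMulVec, dotProduct_comm]
    exact (Complex.pos_iff.1 (dotProduct_star_self_pos_iff.2 hBw)).1
  set K := -((B' * cfc Real.log A').trace).re with hK
  set s := (P * B).trace.re with hs
  -- This is the lower bound from `trace_mul_log_bound` at `t = ε`; its divergence is the infinite
  -- slope.
  have htend : Tendsto (fun ε : ℝ => P.trace.re * (1 - Real.log ε) - s) (𝓝[>] 0) atTop := by
    refine tendsto_atTop_add_const_right _ _ (Tendsto.const_mul_atTop hPtr ?_)
    refine tendsto_atTop_add_const_left _ _ ?_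
    exact tendsto_neg_atBot_atTop.comp Real.tendsto_log_nhdsGT_zero
  obtain ⟨ε, hεK, hε0, hε1⟩ := ((htend.eventually_gt_atTop (c * K)).and
    (Ioo_mem_nhdsGT (zero_lt_one' ℝ))).exists
  refine ⟨ε, hε0, hε1, ?_⟩
  set C := ((1 - ε : ℝ) : ℂ) • A + (ε : ℂ) • B with hC
  set C' := ((1 - ε : ℝ) : ℂ) • A' + (ε : ℂ) • B' with hC'
  have hCs : IsState C := hA.mix hB hε0.le hε1.le
  have hCs' : IsState C' := hA'.mix hB' hε0.le hε1.le
  have h1ε : (0 : ℂ) < ((1 - ε : ℝ) : ℂ) := by exact_mod_cast sub_pos.2 hε1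
  have hεc : (0 : ℂ) < (ε : ℂ) := by exact_mod_cast hε0
  have hkA : ∀ x, C *ᵥ x = 0 → A *ᵥ x = 0 := fun x hx => by
    have := mulVec_eq_zero_of_add_mulVec_eq_zero (hA.1.smul h1ε.le) (hB.1.smul hεc.le) hx
    rw [smul_mulVec] at this
    exact (smul_eq_zero_iff_right h1ε.ne').1 this
  have hkB : ∀ x, C *ᵥ x = 0 → B *ᵥ x = 0 := fun x hx => by
    rw [hC, add_comm] at hx
    have := mulVec_eq_zero_of_add_mulVec_eq_zero (hB.1.smul hεc.le) (hA.1.smul h1ε.le) hx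
    rw [smul_mulVec] at this
    exact (smul_eq_zero_iff_right hεc.ne').1 this
  have hsplit : ∀ {d : Type} [Fintype d] [DecidableEq d] (X Y L : Mat d),
      -(((((1 - ε : ℝ) : ℂ) • X + (ε : ℂ) • Y) * L).trace).re =
        (1 - ε) * -((X * L).trace).re + ε * -((Y * L).trace).re := by
    intro d _ _ X Y L
    rw [add_mul, smul_mul_assoc, smul_mul_assoc, trace_add, trace_smul, trace_smul,
      Complex.add_re, smul_eq_mul, smul_eq_mul, Complex.re_ofReal_mul, Complex.re_ofReal_mul]
    ring
  -- Klein's inequality against the fixed state `A'` gives a bound affine in `ε`, with finite slope.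
  have upper : entropy C' ≤ (1 - ε) * entropy A' + ε * K := by
    refine (klein_inequality hCs'.1 hA'.1 (hCs'.2.trans hA'.2.symm) fun x hx => ?_).trans_eq
      (hsplit _ _ _)
    rw [hC', add_mulVec, smul_mulVec, smul_mulVec, hx, hker x hx, smul_zero, smul_zero, add_zero]
  have lower : (1 - ε) * entropy A + ε * -((B * cfc Real.log C).trace).re ≤ entropy C := by
    have : entropy C = _ := hsplit A B (cfc Real.log C)
    rw [this]
    have := mul_le_mul_of_nonneg_left
      (klein_inequality hA.1 hCs.1 (hA.2.trans hCs.2.symm) hkA) (sub_nonneg.2 hε1.le)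
    linarith
  -- `v` lies in the kernel of `A`, so `P` sees only the `ε` part of the mixture and `Tr (P C) / ε`
  -- is the constant `s`.
  have hPA : P * C = (ε : ℂ) • (P * B) := by
    have : P * A = 0 := by
      rw [hPdef, vecMulVec_mul, ← hA.1.isHermitian.eq, vecMul_conjTranspose, star_star, hAw]
      simp
    rw [hC, mul_add, mul_smul_comm, mul_smul_comm, this, smul_zero, zero_add]
  have hbound := trace_mul_log_bound hP hBP hCs hkB hε0
  rw [hPA, trace_smul, smul_eq_mul, Complex.re_ofReal_mul, mul_div_cancel_left₀ _ hε0.ne'] at hbound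
  have hKL : K < -((B * cfc Real.log C).trace).re :=
    lt_of_mul_lt_mul_left (hεK.trans_le hbound) hc0.le
  have := mul_lt_mul_of_pos_left hKL hε0
  rw [← hent] at upper
  linarith

end Perturbation

/-! ### Complementary channels and minimal dimensions. -/

section Stinespring

variable {a b e : Type}

theorem traceSnd_eq_sum_submatrix [Fintype e] (M : Mat (b × e)) :
    traceSnd M = ∑ k, M.submatrix (fun i => (i, k)) (fun i => (i, k)) := by
  ext i j
  simp [traceSnd, Matrix.sum_apply]

theorem traceSnd_posSemidef [Fintype e] {M : Mat (b × e)} (hM : M.PosSemidef) : (traceSnd M).PosSemidef := by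
  rw [traceSnd_eq_sum_submatrix]
  exact posSemidef_sum _ fun k _ => hM.submatrix _

variable [Fintype a] [Fintype b] [Fintype e]

theorem trace_traceSnd (M : Mat (b × e)) : (traceSnd M).trace = M.trace := by
  simp [trace, traceSnd, Fintype.sum_prod_type]

/-- The map `X ↦ Tr_e (V X V†)`. -/
def outputMap (V : Matrix (b × e) a ℂ) : MatMap a b where
  toFun X := traceSnd (V * X * Vᴴ)
  map_add' X Y := by
    ext i j
    simp [traceSnd, Matrix.mul_add, Matrix.add_mul, Finset.sum_add_distrib]
  map_smul' c X := by
    ext i j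
    simp [traceSnd, Finset.mul_sum]

/-- The map `X ↦ Tr_b (V X V†)`. -/
def environmentMap (V : Matrix (b × e) a ℂ) : MatMap a e where
  toFun X := traceFst (V * X * Vᴴ)
  map_add' X Y := by
    ext i j
    simp [traceFst, Matrix.mul_add, Matrix.add_mul, Finset.sum_add_distrib]
  map_smul' c X := by
    ext i j
    simp [traceFst, Finset.mul_sum]

theorem isComplementary_iff [DecidableEq a] {Φ : MatMap a b} {Φc : MatMap a e} :
    IsComplementary Φ Φc ↔
      ∃ V : Matrix (b × e) a ℂ, Vᴴ * V = 1 ∧ Φ = outputMap V ∧ Φc = environmentMap V := by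
  constructor
  · rintro ⟨V, hV, h⟩
    exact ⟨V, hV, LinearMap.ext fun X => (h X).1, LinearMap.ext fun X => (h X).2⟩
  · rintro ⟨V, hV, rfl, rfl⟩
    exact ⟨V, hV, fun X => ⟨rfl, rfl⟩⟩

/-- The matrix `V` rearranged with only the output index as row index. -/
def outputRows (V : Matrix (b × e) a ℂ) : Matrix b (e × a) ℂ :=
  Matrix.of fun i p => V (i, p.1) p.2

theorem outputMap_one {a b e : Type} [Fintype a] [Fintype e] [DecidableEq a]
    (V : Matrix (b × e) a ℂ) :
    outputMap V 1 = outputRows V * (outputRows V)ᴴ := by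
  ext i j
  change traceSnd (V * 1 * Vᴴ) i j = _
  rw [Matrix.mul_one]
  simp [outputRows, traceSnd, mul_apply, Fintype.sum_prod_type]

/-- The environment map depends on `V` only through the Gram matrix of `outputRows V`; any other
factor of that matrix gives the same map. -/
theorem environmentMap_apply {a b e : Type} [Fintype a] [Fintype b]
    (V : Matrix (b × e) a ℂ) (X : Mat a) (k l : e) :
    environmentMap V X k l =
      ∑ y, ∑ x, X x y * ((outputRows V)ᴴ * outputRows V) (l, y) (k, x) := by
  simp only [environmentMap, outputRows, traceFst, mul_apply, Finset.sum_mul, Finset.mul_sum,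
    LinearMap.coe_mk, AddHom.coe_mk, of_apply, conjTranspose_apply]
  rw [Finset.sum_comm]
  refine Finset.sum_congr rfl fun y _ => ?_
  rw [Finset.sum_comm]
  refine Finset.sum_congr rfl fun x _ => Finset.sum_congr rfl fun i _ => ?_
  ring

/-- The Choi matrix. -/
def choiMatrix [DecidableEq a] (Ψ : MatMap a e) : Mat (e × a) :=
  Matrix.of fun p q => Ψ (Matrix.single p.2 q.2 1) p.1 q.1

theorem choiMatrix_environmentMap {a b e : Type} [Fintype a] [DecidableEq a] [Fintype b]
    (V : Matrix (b × e) a ℂ) :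
    choiMatrix (environmentMap V) = ((outputRows V)ᴴ * outputRows V)ᵀ := by
  ext ⟨k, x⟩ ⟨l, y⟩
  rw [choiMatrix, of_apply, environmentMap_apply, transpose_apply]
  simp [single_apply, ite_and]

theorem rank_outputMap_one [DecidableEq a] (V : Matrix (b × e) a ℂ) :
    (outputMap V 1).rank = (choiMatrix (environmentMap V)).rank := by
  rw [outputMap_one, choiMatrix_environmentMap, rank_transpose, rank_conjTranspose_mul_self,
    rank_self_mul_conjTranspose]

/-- `G` is the vector `V *ᵥ u` reshaped as a matrix, as in the Schmidt decomposition. -/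
theorem exists_outputMap_pure (V : Matrix (b × e) a ℂ) (u : a → ℂ) :
    ∃ G : Matrix b e ℂ, outputMap V (vecMulVec u (star u)) = G * Gᴴ ∧
      environmentMap V (vecMulVec u (star u)) = (Gᴴ * G)ᵀ := by
  have h : V * vecMulVec u (star u) * Vᴴ = vecMulVec (V *ᵥ u) (star (V *ᵥ u)) := by
    rw [mul_vecMulVec, vecMulVec_mul, star_mulVec]
  refine ⟨Matrix.of fun i k => (V *ᵥ u) (i, k), ?_, ?_⟩
  · change traceSnd _ = _
    rw [h]
    ext i j
    simp [traceSnd, mul_apply, vecMulVec_apply]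
  · change traceFst _ = _
    rw [h]
    ext k l
    simp [traceFst, mul_apply, vecMulVec_apply, mul_comm]

/-- The rows are the eigenvectors scaled by square roots of eigenvalues, keeping only the nonzero
ones. -/
theorem exists_conjTranspose_mul_self_eq {n : Type} [Fintype n] [DecidableEq n] {M : Mat n}
    (hM : M.PosSemidef) : ∃ K : Matrix (Fin M.rank) n ℂ, Kᴴ * K = M := by
  have h := hM.isHermitian
  have hcard : Fintype.card (Fin M.rank) = Fintype.card {i // h.eigenvalues i ≠ 0} := by
    rw [Fintype.card_fin, h.rank_eq_card_non_zero_eigs]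
  let f := Fintype.equivOfCardEq hcard
  obtain ⟨U, hU⟩ : ∃ U : Mat n, M = U * diagonal (fun i => (h.eigenvalues i : ℂ)) * Uᴴ :=
    ⟨_, conjTranspose_diagonalization h⟩
  refine ⟨Matrix.of fun i x => (Real.sqrt (h.eigenvalues (f i)) : ℂ) * star (U x (f i)), ?_⟩
  ext x y
  refine Eq.trans ?_ (congrFun (congrFun hU.symm x) y)
  rw [mul_apply, mul_apply]
  simp only [mul_diagonal, conjTranspose_apply, of_apply, star_mul', star_star]
  have hterm : ∀ i, star (Real.sqrt (h.eigenvalues i) : ℂ) * U x i *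
      ((Real.sqrt (h.eigenvalues i) : ℂ) * star (U y i)) =
      U x i * (h.eigenvalues i : ℂ) * star (U y i) := by
    intro i
    have hs : (Real.sqrt (h.eigenvalues i) : ℂ) * (Real.sqrt (h.eigenvalues i) : ℂ) =
        (h.eigenvalues i : ℂ) := by
      rw [← Complex.ofReal_mul, Real.mul_self_sqrt (hM.eigenvalues_nonneg i)]
    rw [RCLike.star_def, Complex.conj_ofReal, ← hs]
    ring
  simp_rw [hterm]
  rw [f.sum_comp fun i => U x i * (h.eigenvalues i : ℂ) * star (U y i)]
  rw [← Finset.subtype_univ]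
  refine (Finset.sum_subtype_eq_sum_filter (s := Finset.univ) (p := fun i => h.eigenvalues i ≠ 0)
    fun i => U x i * (h.eigenvalues i : ℂ) * star (U y i)).trans (Finset.sum_filter_of_ne ?_)
  intro i _ hne h0
  simp [h0] at hne

theorem conjTranspose_mul_self_apply {a b e : Type} [Fintype b] [Fintype e]
    (V : Matrix (b × e) a ℂ) (x y : a) :
    (Vᴴ * V) x y = ∑ k, ((outputRows V)ᴴ * outputRows V) (k, x) (k, y) := by
  simp only [mul_apply, Fintype.sum_prod_type, outputRows, of_apply, conjTranspose_apply]
  rw [Finset.sum_comm]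

variable [DecidableEq a]

/-- Refactoring the Gram matrix of `outputRows V` with as few rows as its rank preserves both the
isometry condition and `Φc`. -/
theorem exists_isComplementary_of_rank [DecidableEq e] {Φ : MatMap a b} {Φc : MatMap a e}
    (h : IsComplementary Φ Φc) :
    ∃ Φ' : MatMap a (Fin (Φ 1).rank), IsComplementary Φ' Φc := by
  obtain ⟨V, hV, rfl, rfl⟩ := isComplementary_iff.1 h
  have hr : (outputMap V 1).rank = ((outputRows V)ᴴ * outputRows V).rank := by
    rw [outputMap_one, rank_conjTranspose_mul_self, rank_self_mul_conjTranspose]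
  rw [hr]
  obtain ⟨K, hK⟩ := exists_conjTranspose_mul_self_eq
    (posSemidef_conjTranspose_mul_self (outputRows V))
  let V' : Matrix (Fin ((outputRows V)ᴴ * outputRows V).rank × e) a ℂ :=
    Matrix.of fun p x => K p.1 (p.2, x)
  have hV' : outputRows V' = K := rfl
  refine ⟨outputMap V', isComplementary_iff.2 ⟨V', ?_, rfl, ?_⟩⟩
  · rw [← hV]
    ext x y
    rw [conjTranspose_mul_self_apply, conjTranspose_mul_self_apply, hV', hK]
  · ext X k l
    rw [environmentMap_apply, environmentMap_apply, hV', hK]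

theorem IsComplementary.symm {Φ : MatMap a b} {Φc : MatMap a e} (h : IsComplementary Φ Φc) :
    IsComplementary Φc Φ := by
  obtain ⟨V, hV, rfl, rfl⟩ := isComplementary_iff.1 h
  refine isComplementary_iff.2 ⟨V.submatrix Prod.swap id, ?_, rfl, rfl⟩
  rw [← hV, conjTranspose_submatrix]
  exact submatrix_mul_equiv _ _ id (Equiv.prodComm e b) id

theorem IsComplementary.posSemidef_apply {Φ : MatMap a b} {Φc : MatMap a e}
    (h : IsComplementary Φ Φc) {X : Mat a} (hX : X.PosSemidef) : (Φ X).PosSemidef := by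
  obtain ⟨V, -, rfl, -⟩ := isComplementary_iff.1 h
  exact traceSnd_posSemidef (hX.mul_mul_conjTranspose_same V)

theorem IsComplementary.isState_apply {Φ : MatMap a b} {Φc : MatMap a e}
    (h : IsComplementary Φ Φc) {ρ : Mat a} (hρ : IsState ρ) : IsState (Φ ρ) := by
  refine ⟨h.posSemidef_apply hρ.1, ?_⟩
  obtain ⟨V, hV, rfl, -⟩ := isComplementary_iff.1 h
  change (traceSnd (V * ρ * Vᴴ)).trace = 1
  rw [trace_traceSnd, trace_mul_cycle, hV, one_mul, hρ.2]

theorem IsComplementary.rank_apply_one {Φ : MatMap a b} {Φc : MatMap a e}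
    (h : IsComplementary Φ Φc) : (Φ 1).rank = (choiMatrix Φc).rank := by
  obtain ⟨V, hV, rfl, rfl⟩ := isComplementary_iff.1 h
  exact rank_outputMap_one V

theorem IsComplementary.rank_pure {Φ : MatMap a b} {Φc : MatMap a e}
    (h : IsComplementary Φ Φc) (u : a → ℂ) :
    (Φ (vecMulVec u (star u))).rank = (Φc (vecMulVec u (star u))).rank := by
  obtain ⟨V, hV, rfl, rfl⟩ := isComplementary_iff.1 h
  obtain ⟨G, h₁, h₂⟩ := exists_outputMap_pure V u
  rw [h₁, h₂, rank_transpose, rank_conjTranspose_mul_self, rank_self_mul_conjTranspose]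

/-- The value is attained by compressing the environment. It is a lower bound because `(Ψ 1).rank`
is the Choi rank of `Φ` for every complement `Ψ`. -/
theorem IsComplementary.minEnvDim_eq [DecidableEq b] {Φ : MatMap a b} {Φc : MatMap a e}
    (h : IsComplementary Φ Φc) : minEnvDim Φ = (Φc 1).rank := by
  obtain ⟨Φ', hΦ'⟩ := exists_isComplementary_of_rank h.symm
  refine le_antisymm (Nat.sInf_le ⟨Φ', hΦ'.symm⟩) (le_csInf ⟨_, Φ', hΦ'.symm⟩ ?_)
  rintro m ⟨Ψ, hΨ⟩
  rw [h.symm.rank_apply_one, ← hΨ.symm.rank_apply_one]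
  exact (rank_le_width _)

theorem IsComplementary.minOutDim_eq [DecidableEq b] {m : ℕ} {Φ : MatMap a b} {Φc : MatMap a (Fin m)}
    (h : IsComplementary Φ Φc) : minOutDim Φ = (Φ 1).rank := by
  have hset : {r : ℕ | ∃ (m : ℕ) (Φc : MatMap a (Fin m)), IsComplementary Φ Φc ∧
      r = minEnvDim Φc} = {(Φ 1).rank} := by
    ext r
    constructor
    · rintro ⟨m', Ψ, hΨ, rfl⟩
      exact hΨ.symm.minEnvDim_eq
    · rintro rfl
      exact ⟨m, Φc, h, h.symm.minEnvDim_eq.symm⟩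
  rw [minOutDim, hset, csInf_singleton]

variable [DecidableEq b] [DecidableEq e]

theorem IsComplementary.entropy_pure {Φ : MatMap a b} {Φc : MatMap a e}
    (h : IsComplementary Φ Φc) (u : a → ℂ) :
    entropy (Φ (vecMulVec u (star u))) = entropy (Φc (vecMulVec u (star u))) := by
  obtain ⟨V, hV, rfl, rfl⟩ := isComplementary_iff.1 h
  obtain ⟨G, h₁, h₂⟩ := exists_outputMap_pure V u
  rw [h₁, h₂, entropy_transpose (isHermitian_conjTranspose_mul_self G),
    entropy_self_mul_conjTranspose]

end Stinespring

/-! ### Additivity of coherent information on product states. -/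

section TensorProduct

variable {a b a₁ b₁ e₁ a₂ b₂ e₂ : Type}

theorem linearMap_ext_single [Fintype a] [DecidableEq a] {Φ Ψ : MatMap a b}
    (h : ∀ k l, Φ (single k l 1) = Ψ (single k l 1)) : Φ = Ψ := by
  ext X : 1
  rw [matrix_eq_sum_single X]
  simp only [map_sum]
  refine Finset.sum_congr rfl fun k _ => Finset.sum_congr rfl fun l _ => ?_
  have : single k l (X k l) = X k l • single k l (1 : ℂ) := by rw [smul_single, smul_eq_mul, mul_one]
  rw [this, map_smul, map_smul, h]

theorem IsState.kronecker_reindex [Fintype a] [Fintype a₁] [Fintype a₂] {ρ₁ : Mat a₁} {ρ₂ : Mat a₂} (h₁ : IsState ρ₁)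
    (h₂ : IsState ρ₂) (f : a₁ × a₂ ≃ a) :
    IsState (reindex f f (kroneckerMap (· * ·) ρ₁ ρ₂)) := by
  refine ⟨(h₁.1.kronecker h₂.1).submatrix _, ?_⟩
  have : (reindex f f (kroneckerMap (· * ·) ρ₁ ρ₂)).trace = (kroneckerMap (· * ·) ρ₁ ρ₂).trace := by
    simp only [trace, diag_apply, reindex_apply, submatrix_apply]
    exact f.symm.sum_comp fun i => kroneckerMap (· * ·) ρ₁ ρ₂ i i
  rw [this, trace_kronecker, h₁.2, h₂.2, one_mul]

theorem entropy_kronecker_reindex [Fintype a] [DecidableEq a] [Fintype a₁] [DecidableEq a₁]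
    [Fintype a₂] [DecidableEq a₂] {ρ₁ : Mat a₁} {ρ₂ : Mat a₂} (h₁ : IsState ρ₁)
    (h₂ : IsState ρ₂) (f : a₁ × a₂ ≃ a) :
    entropy (reindex f f (kroneckerMap (· * ·) ρ₁ ρ₂)) = entropy ρ₁ + entropy ρ₂ := by
  rw [entropy_reindex (h₁.1.kronecker h₂.1).isHermitian, entropy_kronecker h₁ h₂]

/-- The tensor product of two Stinespring isometries, with the tensor factors sorted. -/
def tensorIsometry {e : Type} (V₁ : Matrix (b₁ × e₁) a₁ ℂ) (V₂ : Matrix (b₂ × e₂) a₂ ℂ)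
    (fa : a₁ × a₂ ≃ a) (fb : b₁ × b₂ ≃ b) (fe : e₁ × e₂ ≃ e) : Matrix (b × e) a ℂ :=
  (kroneckerMap (· * ·) V₁ V₂).submatrix
    ((fb.symm.prodCongr fe.symm).trans (Equiv.prodProdProdComm b₁ b₂ e₁ e₂)) fa.symm

variable {e : Type} (V₁ : Matrix (b₁ × e₁) a₁ ℂ) (V₂ : Matrix (b₂ × e₂) a₂ ℂ)
  (fa : a₁ × a₂ ≃ a) (fb : b₁ × b₂ ≃ b) (fe : e₁ × e₂ ≃ e)

theorem tensorIsometry_isometry [DecidableEq a] [Fintype b] [Fintype e] [DecidableEq a₁]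
    [Fintype b₁] [Fintype e₁] [DecidableEq a₂] [Fintype b₂] [Fintype e₂]
    (h₁ : V₁ᴴ * V₁ = 1) (h₂ : V₂ᴴ * V₂ = 1) :
    (tensorIsometry V₁ V₂ fa fb fe)ᴴ * tensorIsometry V₁ V₂ fa fb fe = 1 := by
  rw [tensorIsometry, conjTranspose_submatrix, submatrix_mul_equiv, conjTranspose_kronecker,
    ← mul_kronecker_mul, h₁, h₂, one_kronecker_one, submatrix_one_equiv]

variable [Fintype a] [Fintype a₁] [Fintype a₂]

theorem tensorIsometry_conj (ρ₁ : Mat a₁) (ρ₂ : Mat a₂) :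
    tensorIsometry V₁ V₂ fa fb fe * reindex fa fa (kroneckerMap (· * ·) ρ₁ ρ₂) *
      (tensorIsometry V₁ V₂ fa fb fe)ᴴ =
    (kroneckerMap (· * ·) (V₁ * ρ₁ * V₁ᴴ) (V₂ * ρ₂ * V₂ᴴ)).submatrix
      ((fb.symm.prodCongr fe.symm).trans (Equiv.prodProdProdComm b₁ b₂ e₁ e₂))
      ((fb.symm.prodCongr fe.symm).trans (Equiv.prodProdProdComm b₁ b₂ e₁ e₂)) := by
  rw [tensorIsometry, conjTranspose_submatrix, reindex_apply, submatrix_mul_equiv,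
    submatrix_mul_equiv, conjTranspose_kronecker, ← mul_kronecker_mul, ← mul_kronecker_mul]

theorem outputMap_tensorIsometry [Fintype e] [Fintype e₁] [Fintype e₂]
    (ρ₁ : Mat a₁) (ρ₂ : Mat a₂) :
    outputMap (tensorIsometry V₁ V₂ fa fb fe) (reindex fa fa (kroneckerMap (· * ·) ρ₁ ρ₂)) =
      reindex fb fb (kroneckerMap (· * ·) (outputMap V₁ ρ₁) (outputMap V₂ ρ₂)) := by
  change traceSnd _ = _
  rw [tensorIsometry_conj]
  ext i j
  simp only [traceSnd, of_apply, submatrix_apply, kroneckerMap_apply, reindex_apply,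
    outputMap, LinearMap.coe_mk, AddHom.coe_mk]
  rw [Finset.sum_mul_sum, ← Fintype.sum_prod_type', ← fe.symm.sum_comp]
  rfl

theorem environmentMap_tensorIsometry [Fintype b] [Fintype b₁] [Fintype b₂]
    (ρ₁ : Mat a₁) (ρ₂ : Mat a₂) :
    environmentMap (tensorIsometry V₁ V₂ fa fb fe)
        (reindex fa fa (kroneckerMap (· * ·) ρ₁ ρ₂)) =
      reindex fe fe (kroneckerMap (· * ·) (environmentMap V₁ ρ₁) (environmentMap V₂ ρ₂)) := by
  change traceFst _ = _
  rw [tensorIsometry_conj]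
  ext i j
  simp only [traceFst, of_apply, submatrix_apply, kroneckerMap_apply, reindex_apply,
    environmentMap, LinearMap.coe_mk, AddHom.coe_mk]
  rw [Finset.sum_mul_sum, ← Fintype.sum_prod_type', ← fb.symm.sum_comp]
  rfl

/-- Evaluate the tensor product isometry on a product state, where both output entropies add. The
index bijections are left free to cover both appending and prepending of tensor factors. -/
theorem add_mem_coherentInfoValues [DecidableEq a] [DecidableEq a₁] [DecidableEq a₂]
    [Fintype b] [DecidableEq b] [Fintype b₁] [DecidableEq b₁] [Fintype b₂] [DecidableEq b₂]
    {Φ₁ : MatMap a₁ b₁} {Φ₂ : MatMap a₂ b₂} {Φ : MatMap a b}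
    (fa : a₁ × a₂ ≃ a) (fb : b₁ × b₂ ≃ b)
    (hΦ : ∀ k l i j, Φ (single (fa k) (fa l) 1) (fb i) (fb j) =
      Φ₁ (single k.1 l.1 1) i.1 j.1 * Φ₂ (single k.2 l.2 1) i.2 j.2)
    {x y : ℝ} (hx : x ∈ coherentInfoValues Φ₁) (hy : y ∈ coherentInfoValues Φ₂) :
    x + y ∈ coherentInfoValues Φ := by
  obtain ⟨m₁, Ψ₁, ρ₁, hc₁, hρ₁, rfl⟩ := hx
  obtain ⟨m₂, Ψ₂, ρ₂, hc₂, hρ₂, rfl⟩ := hy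
  have hs₁ := hc₁.isState_apply hρ₁
  have hs₂ := hc₂.isState_apply hρ₂
  have hs₁' := hc₁.symm.isState_apply hρ₁
  have hs₂' := hc₂.symm.isState_apply hρ₂
  obtain ⟨V₁, hV₁, rfl, rfl⟩ := isComplementary_iff.1 hc₁
  obtain ⟨V₂, hV₂, rfl, rfl⟩ := isComplementary_iff.1 hc₂
  set V := tensorIsometry V₁ V₂ fa fb finProdFinEquiv with hV
  have hout : Φ = outputMap V := by
    refine linearMap_ext_single fun k l => ?_
    have hsingle : single k l (1 : ℂ) = reindex fa fa (kroneckerMap (· * ·)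
        (single (fa.symm k).1 (fa.symm l).1 1) (single (fa.symm k).2 (fa.symm l).2 1)) := by
      rw [single_kronecker_single]
      simp
    conv_rhs => rw [hsingle, hV, outputMap_tensorIsometry]
    ext i j
    have := hΦ (fa.symm k) (fa.symm l) (fb.symm i) (fb.symm j)
    simpa using this
  refine ⟨m₁ * m₂, environmentMap V, reindex fa fa (kroneckerMap (· * ·) ρ₁ ρ₂),
    isComplementary_iff.2 ⟨V, tensorIsometry_isometry V₁ V₂ fa fb _ hV₁ hV₂, hout, rfl⟩,
    hρ₁.kronecker_reindex hρ₂ fa, ?_⟩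
  rw [hout, hV, outputMap_tensorIsometry, environmentMap_tensorIsometry,
    entropy_kronecker_reindex hs₁ hs₂, entropy_kronecker_reindex hs₁' hs₂']
  ring

end TensorProduct

/-! ### Superadditivity and the regularized limit. -/

section Capacity

variable {a b : Type} [Fintype a] [DecidableEq a] [Fintype b] [DecidableEq b] (Φ : MatMap a b)

theorem tensorPower_single {a b : Type} [Fintype a] [DecidableEq a] (Φ : MatMap a b) (n : ℕ) (k l : Fin n → a) (i j : Fin n → b) :
    tensorPower Φ n (single k l 1) i j = ∏ t, Φ (single (k t) (l t) 1) (i t) (j t) := by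
  simp [tensorPower, single_apply, ite_and]

theorem add_mem_coherentInfoValues_tensorPower {m n : ℕ} {x y : ℝ}
    (hx : x ∈ coherentInfoValues (tensorPower Φ m))
    (hy : y ∈ coherentInfoValues (tensorPower Φ n)) :
    x + y ∈ coherentInfoValues (tensorPower Φ (m + n)) := by
  refine add_mem_coherentInfoValues (Fin.appendEquiv m n) (Fin.appendEquiv m n) ?_ hx hy
  intro k l i j
  simp only [tensorPower_single, Fin.prod_univ_add, Fin.appendEquiv, Equiv.coe_fn_mk,
    Fin.append_left, Fin.append_right]

theorem zero_mem_coherentInfoValues_tensorPower_zero :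
    0 ∈ coherentInfoValues (tensorPower Φ 0) := by
  let V : Matrix ((Fin 0 → b) × Fin 1) (Fin 0 → a) ℂ := Matrix.of fun _ _ => 1
  have hV : Vᴴ * V = 1 := by
    ext x y
    obtain rfl := Subsingleton.elim x y
    simp [V, mul_apply]
  have hout : tensorPower Φ 0 = outputMap V := by
    refine linearMap_ext_single fun k l => ?_
    ext i j
    rw [tensorPower_single]
    simp [V, outputMap, traceSnd, mul_apply, Subsingleton.elim k default,
      Subsingleton.elim l default]
  have hc : IsComplementary (tensorPower Φ 0) (environmentMap V) :=
    isComplementary_iff.2 ⟨V, hV, hout, rfl⟩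
  have hρ : IsState (1 : Mat (Fin 0 → a)) := ⟨PosSemidef.one, by simp [trace]⟩
  have hzero : ∀ {c : Type} [Fintype c] [DecidableEq c] [Unique c] {σ : Mat c}, IsState σ →
      entropy σ = 0 := by
    intro c _ _ _ σ hσ
    refine le_antisymm ((entropy_le_log_card hσ).trans_eq ?_) (entropy_nonneg hσ)
    simp
  refine ⟨1, environmentMap V, 1, hc, hρ, ?_⟩
  rw [hzero (hc.isState_apply hρ), hzero (hc.symm.isState_apply hρ), sub_zero]

variable {Φ}

theorem mem_coherentInfoValues_tensorPower_one {x : ℝ} (hx : x ∈ coherentInfoValues Φ) :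
    x ∈ coherentInfoValues (tensorPower Φ 1) := by
  rw [← add_zero x]
  refine add_mem_coherentInfoValues (Fin.consEquiv fun _ => a) (Fin.consEquiv fun _ => b) ?_ hx
    (zero_mem_coherentInfoValues_tensorPower_zero Φ)
  intro k l i j
  rw [tensorPower_single, tensorPower_single, Fin.prod_univ_succ]
  rfl

theorem coherentInfoValues_tensorPower_nonempty (hne : (coherentInfoValues Φ).Nonempty) (n : ℕ) :
    (coherentInfoValues (tensorPower Φ n)).Nonempty := by
  obtain ⟨x, hx⟩ := hne
  induction n with
  | zero => exact ⟨0, zero_mem_coherentInfoValues_tensorPower_zero Φ⟩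
  | succ n ih =>
    obtain ⟨y, hy⟩ := ih
    exact ⟨_, add_mem_coherentInfoValues_tensorPower Φ hy
      (mem_coherentInfoValues_tensorPower_one hx)⟩

theorem le_log_card_of_mem_coherentInfoValues {x : ℝ} (hx : x ∈ coherentInfoValues Φ) :
    x ≤ Real.log (Fintype.card b) := by
  obtain ⟨m, Ψ, ρ, hc, hρ, rfl⟩ := hx
  have h₁ := entropy_le_log_card (hc.isState_apply hρ)
  have h₂ := entropy_nonneg (hc.symm.isState_apply hρ)
  linarith

theorem bddAbove_coherentInfoValues : BddAbove (coherentInfoValues Φ) :=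
  ⟨_, fun _ => le_log_card_of_mem_coherentInfoValues⟩

theorem coherentInfo_tensorPower_superadditive (hne : (coherentInfoValues Φ).Nonempty) (m n : ℕ) :
    coherentInfo (tensorPower Φ m) + coherentInfo (tensorPower Φ n) ≤
      coherentInfo (tensorPower Φ (m + n)) := by
  rw [coherentInfo, coherentInfo, ← csSup_add (coherentInfoValues_tensorPower_nonempty hne m)
    bddAbove_coherentInfoValues (coherentInfoValues_tensorPower_nonempty hne n)
    bddAbove_coherentInfoValues]
  refine csSup_le_csSup bddAbove_coherentInfoValues
    ((coherentInfoValues_tensorPower_nonempty hne m).add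
      (coherentInfoValues_tensorPower_nonempty hne n)) ?_
  rintro _ ⟨x, hx, y, hy, rfl⟩
  exact add_mem_coherentInfoValues_tensorPower Φ hx hy

theorem coherentInfo_tensorPower_div_le (hne : (coherentInfoValues Φ).Nonempty) (n : ℕ) :
    coherentInfo (tensorPower Φ n) / n ≤ Real.log (Fintype.card b) := by
  rcases n.eq_zero_or_pos with rfl | hn
  · simpa using Real.log_natCast_nonneg _
  rw [div_le_iff₀ (by exact_mod_cast hn)]
  refine csSup_le (coherentInfoValues_tensorPower_nonempty hne n) fun x hx => ?_
  refine (le_log_card_of_mem_coherentInfoValues hx).trans_eq ?_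
  rw [Fintype.card_fun, Fintype.card_fin, Nat.cast_pow, Real.log_pow, mul_comm]

/-- Fekete's lemma for the negated sequence: the limit exists and is bounded by the term at `n = 1`,
so the capacity is at least `x`. -/
theorem hasPositiveQuantumCapacity_of_mem {x : ℝ} (hx : x ∈ coherentInfoValues Φ) (h0 : 0 < x) :
    HasPositiveQuantumCapacity Φ := by
  have hne : (coherentInfoValues Φ).Nonempty := ⟨x, hx⟩
  have hsub : Subadditive fun n => -coherentInfo (tensorPower Φ n) := fun m n => by
    have := coherentInfo_tensorPower_superadditive hne m n
    linarith
  have hbdd : BddBelow (Set.range fun n : ℕ => -coherentInfo (tensorPower Φ n) / n) := by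
    refine ⟨-Real.log (Fintype.card b), ?_⟩
    rintro _ ⟨n, rfl⟩
    have := coherentInfo_tensorPower_div_le hne n
    simp only [neg_div]
    linarith
  refine ⟨-hsub.lim, ?_, ?_⟩
  · have := (hsub.tendsto_lim hbdd).neg
    simpa [IsQuantumCapacity, neg_div] using this
  · have h₁ := hsub.lim_le_div hbdd one_ne_zero
    have h₂ : x ≤ coherentInfo (tensorPower Φ 1) :=
      le_csSup bddAbove_coherentInfoValues (mem_coherentInfoValues_tensorPower_one hx)
    rw [Nat.cast_one, div_one] at h₁
    linarith

end Capacity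

/-! ### Positive capacity from a rank gap. -/

section Main

variable {a b : Type} [Fintype a] [DecidableEq a] [Fintype b] [DecidableEq b]

theorem _root_.Matrix.PosSemidef.isState_inv_trace_smul {n : Type} [Fintype n] {X : Mat n}
    (hX : X.PosSemidef) (h : 0 < X.trace) : IsState (X.trace⁻¹ • X) :=
  ⟨hX.smul (inv_nonneg.2 h.le), by rw [trace_smul, smul_eq_mul, inv_mul_cancel₀ h.ne']⟩

/-- A channel has positive quantum capacity if some pure state is mapped by a complementary
channel to a state of full support which is of smaller rank than the output of the channel. -/
theorem hasPositiveQuantumCapacity_of_rank_lt {m : ℕ} {Φ : MatMap a b}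
    {Ψ : MatMap a (Fin m)} (h : IsComplementary Φ Ψ) (u : a → ℂ)
    (hu : u ≠ 0) (hfull : (Ψ (vecMulVec u (star u))).rank = (Ψ 1).rank) (hlt : (Ψ 1).rank < (Φ 1).rank) :
    HasPositiveQuantumCapacity Φ := by
  have hne : Nonempty a := ⟨(Function.ne_iff.1 hu).choose⟩
  set P : Mat a := vecMulVec u (star u) with hPdef
  have hP : P.PosSemidef := posSemidef_vecMulVec_self_star u
  have hPtr : 0 < P.trace := by
    rw [hPdef, trace_vecMulVec, dotProduct_comm]
    exact dotProduct_star_self_pos_iff.2 hu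
  have hItr : 0 < (1 : Mat a).trace := by
    rw [trace_one]
    exact_mod_cast Fintype.card_pos
  have hρ₀ := hP.isState_inv_trace_smul hPtr
  have hρ₁ := (PosSemidef.one (n := a) (R := ℂ)).isState_inv_trace_smul hItr
  -- `P` is dominated by a multiple of the identity, so the kernel of `Ψ 1` lies in that of `Ψ P`;
  -- equal ranks make them equal.
  have hker : ∀ v, Ψ P *ᵥ v = 0 → Ψ 1 *ᵥ v = 0 := by
    have hle : LinearMap.ker (Ψ 1).mulVecLin ≤ LinearMap.ker (Ψ P).mulVecLin := by
      intro v hv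
      rw [LinearMap.mem_ker, mulVecLin_apply] at hv ⊢
      have hdom := posSemidef_smul_sub_vecMulVec (PosSemidef.one (n := a) (R := ℂ)) u
      rw [one_mulVec] at hdom
      refine mulVec_eq_zero_of_add_mulVec_eq_zero (h.symm.posSemidef_apply hP)
        (h.symm.posSemidef_apply hdom) ?_
      rw [← map_add, add_sub_cancel, map_smul, smul_mulVec, hv, smul_zero]
    have h₁ := LinearMap.finrank_range_add_finrank_ker (Ψ 1).mulVecLin
    have h₂ := LinearMap.finrank_range_add_finrank_ker (Ψ P).mulVecLin
    have heq := Submodule.eq_of_le_of_finrank_eq hle (by simp only [rank] at hfull; omega)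
    intro v hv
    have : v ∈ LinearMap.ker (Ψ 1).mulVecLin := heq ▸ hv
    exact this
  have hrank : (Φ (P.trace⁻¹ • P)).rank < (Φ ((1 : Mat a).trace⁻¹ • 1)).rank := by
    rw [map_smul, map_smul, rank_smul_of_mem_nonZeroDivisors _
      (mem_nonZeroDivisors_of_ne_zero (inv_ne_zero hPtr.ne')), rank_smul_of_mem_nonZeroDivisors _
      (mem_nonZeroDivisors_of_ne_zero (inv_ne_zero hItr.ne')), h.rank_pure, hfull]
    exact hlt
  have hent : entropy (Φ (P.trace⁻¹ • P)) = entropy (Ψ (P.trace⁻¹ • P)) := by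
    -- The normalization is absorbed into the vector, so that the pure-state lemma applies.
    have hsq : P.trace⁻¹ • P = vecMulVec (((Real.sqrt P.trace.re⁻¹ : ℝ) : ℂ) • u)
        (star (((Real.sqrt P.trace.re⁻¹ : ℝ) : ℂ) • u)) := by
      rw [star_smul, smul_vecMulVec, vecMulVec_smul, smul_smul, RCLike.star_def,
        Complex.conj_ofReal, ← Complex.ofReal_mul, Real.mul_self_sqrt
        (inv_nonneg.2 (Complex.pos_iff.1 hPtr).1.le), Complex.ofReal_inv,
        ← Complex.eq_re_of_ofReal_le (r := 0) (by simpa using hPtr.le)]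
    rw [hsq]
    exact h.entropy_pure _
  obtain ⟨ε, hε0, hε1, hε⟩ := exists_mix_entropy_lt (h.isState_apply hρ₀) (h.isState_apply hρ₁)
    (h.symm.isState_apply hρ₀) (h.symm.isState_apply hρ₁) hrank hent fun v hv => by
      rw [map_smul, smul_mulVec] at hv ⊢
      rw [hker v ((smul_eq_zero_iff_right (inv_ne_zero hPtr.ne')).1 hv), smul_zero]
  refine hasPositiveQuantumCapacity_of_mem
    ⟨m, Ψ, _, h, hρ₀.mix hρ₁ hε0.le hε1.le, rfl⟩ (sub_pos.2 ?_)
  simpa only [map_add, map_smul] using hε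

end Main

end QCap

theorem theorem4p8 (d : ℕ) (Φ : QCap.MatMap (Fin d) (Fin d))
    (hΦ : QCap.IsChannel Φ) (hcov : QCap.IsDUC Φ ∨ QCap.IsCDUC Φ)
    (hrank : (Φ (QCap.eProj d)).rank = min (QCap.minOutDim Φ) (QCap.minEnvDim Φ)) :
    (QCap.minEnvDim Φ < QCap.minOutDim Φ → QCap.HasPositiveQuantumCapacity Φ) ∧
    (QCap.minOutDim Φ < QCap.minEnvDim Φ →
      ∀ (m : ℕ) (Φc : QCap.MatMap (Fin d) (Fin m)),
        QCap.IsComplementary Φ Φc → QCap.HasPositiveQuantumCapacity Φc) := by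
  -- A strict rank inequality rules out `d = 0`.
  have hne : ∀ {m : ℕ} (Ψ : QCap.MatMap (Fin d) (Fin m)) {r : ℕ}, r < (Ψ 1).rank →
      (fun _ : Fin d => (1 : ℂ)) ≠ 0 := by
    intro m Ψ r hr h
    have : IsEmpty (Fin d) := ⟨fun i => one_ne_zero (congrFun h i)⟩
    rw [Subsingleton.elim (1 : QCap.Mat (Fin d)) 0, map_zero, Matrix.rank_zero] at hr
    exact Nat.not_lt_zero _ hr
  constructor
  · intro hlt
    -- A complementary channel exists because the infimum defining `minOutDim` is positive, whereas
    -- the infimum of the empty set is `0`.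
    obtain ⟨_, m, Φc, hc, -⟩ := Nat.nonempty_of_pos_sInf (Nat.zero_lt_of_lt hlt)
    rw [hc.minOutDim_eq, hc.minEnvDim_eq] at hlt hrank
    refine QCap.hasPositiveQuantumCapacity_of_rank_lt hc (fun _ => 1) (hne Φ hlt) ?_ hlt
    rw [← hc.rank_pure]
    exact hrank.trans (min_eq_right hlt.le)
  · intro hlt m Φc hc
    rw [hc.minOutDim_eq, hc.minEnvDim_eq] at hlt hrank
    exact QCap.hasPositiveQuantumCapacity_of_rank_lt hc.symm (fun _ => 1) (hne Φc hlt)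
      (hrank.trans (min_eq_left hlt.le)) hlt
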